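/- Consider a fully connected feedforward neural network with layers $0,\dots,L$ having $m_0,\dots,m_L$ nodes, weights $w^{(l)}_{ja}$ (from node $j$ of layer $l$ to node $a$ of layer $l+1$), biases $b^{(l)}_a$ and activation maps $f^{(l)}:\mathbb R^{m_{l+1}}\to\mathbb R^{m_{l+1}}$, $0\le l<L$ (acting node by node, or jointly as softmax does). For an input $x\in\mathbb R^{m_0}$ and a noise vector $e=(e^{(l)}_{ja})$ with one entry per connection, put $X^{(0)}=x$ and $$X^{(l+1)}=f^{(l)}\big(u^{(l+1)}\big),\qquad u^{(l+1)}_a=b^{(l)}_a+\sum_{j}w^{(l)}_{ja}\big(X^{(l)}_j+e^{(l)}_{ja}\big),$$ and let $f(x,e\mid w,b)=X^{(L)}$ be the output of the perturbed network. For $n\ge1$ training cases $(x_i,y_i)$ and $k\ge 1$ epochs, the noise perturbed empirical loss function (pelf) is $$l_p(w,b\mid x,y,e)=\frac1{kn}\sum_{j=1}^{k}\sum_{i=1}^{n}\big\|f(x_i,e_{ij}\mid w,b)-y_i\big\|^2,$$ a function of the collective noise $e=(e_{ij})_{i\le n,\,j\le k}$, where $\|\cdot\|$ is the Euclidean norm.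 (Additive) Gaussian whiteout noise with tuning parameters $\sigma^2\ge0$, $\lambda\ge0$, $\gamma\in(0,2)$ means that all entries of $e$ are independent and the entry of $e_{ij}$ on a connection of weight $w$ has law $N(0,\sigma^2|w|^{-\gamma}+\lambda)$ (for $w=0$ read $|w|^{-\gamma}$ as $0$; this is immaterial, since that entry is multiplied by $w=0$). Assume that the activations $f^{(l)}$ are Lipschitz continuous, that the weights are bounded, $|w^{(l)}_{ja}|\le R$, that the outputs are bounded, $\|y_i\|\le C$ for all $i$, and that the loss is uniformly bounded, $\|f(x_i,e\mid w,b)-y_i\|^2\le M$ for all $i$ and all noise vectors $e$. Then there is a constant $B>0$, depending only on the layer sizes, the activations, $\sigma,\gamma,\lambda,R,C$ and $M$ (in particular not on $n$, $k$, $\delta$, the data, or the particular weights and biases), such that $e\mapsto l_p(w,b\mid x,y,e)$ is $B/\sqrt{kn}$-Lipschitz with respect to the Euclidean norm and, when $e$ is Gaussian whiteout noise, $l_p(w,b\mid x,y,e)$ is integrable and for every $\delta>0$ $$\Pr\Big(\big|l_p(w,b\mid x,y,e)-\mathrm E_e\, l_p(w,b\mid x,y,e)\big|>\delta\Big)\le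 2\exp\Big(-\frac{kn\,\delta^2}{2B^2}\Big).$$ -/

import Mathlib

open MeasureTheory ProbabilityTheory
open scoped NNReal

noncomputable section

namespace Whiteout

/-- The connections of a fully connected feedforward network whose layers are numbered
`0, …, L` (layer `0` is the input, layer `L` the output) and have `m 0, …, m L` nodes: a
triple `⟨l, j, k⟩` is the connection from node `j` of layer `l` to node `k` of layer `l + 1`.
Noise is injected on every connection, that is, into the input and all hidden layers. -/
abbrev Edge {L : ℕ} (m : Fin (L + 1) → ℕ) : Type :=
  Σ l : Fin L, Fin (m l.castSucc) × Fin (m l.succ)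

/-- The space of values of a layer with `d` nodes, with the Euclidean norm. -/
abbrev Nodes (d : ℕ) : Type := EuclideanSpace ℝ (Fin d)

/-- Weights: `w l j k` is the weight of the connection `⟨l, j, k⟩`. -/
abbrev Weights {L : ℕ} (m : Fin (L + 1) → ℕ) : Type :=
  ∀ l : Fin L, Matrix (Fin (m l.castSucc)) (Fin (m l.succ)) ℝ

/-- Biases: `b l k` is the bias of node `k` of layer `l + 1`. -/
abbrev Biases {L : ℕ} (m : Fin (L + 1) → ℕ) : Type :=
  ∀ l : Fin L, Fin (m l.succ) → ℝ

/-- Activations: `act l` maps the pre-activations of layer `l + 1` to its node values. It may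
act on every node separately (sigmoid, tanh, …) or jointly (softmax). -/
abbrev Activations {L : ℕ} (m : Fin (L + 1) → ℕ) : Type :=
  ∀ l : Fin L, Nodes (m l.succ) → Nodes (m l.succ)

/-- Values of the layers of the noise-perturbed network on the input `x`: the signal sent from
node `j` of layer `l` to node `k` of the next layer is perturbed to `X j + e ⟨l, j, k⟩`. -/
def layer {L : ℕ} {m : Fin (L + 1) → ℕ} (act : Activations m) (w : Weights m) (b : Biases m)
    (x : Nodes (m 0)) (e : Edge m → ℝ) (l : Fin (L + 1)) : Nodes (m l) :=
  Fin.induction (motive := fun l => Nodes (m l)) x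
    (fun l X => act l (WithLp.toLp 2 fun k => b l k + ∑ j, w l j k * (X j + e ⟨l, j, k⟩))) l

/-- The output of the noise-perturbed network. -/
def output {L : ℕ} {m : Fin (L + 1) → ℕ} (act : Activations m) (w : Weights m) (b : Biases m)
    (x : Nodes (m 0)) (e : Edge m → ℝ) : Nodes (m (Fin.last L)) :=
  layer act w b x e (Fin.last L)

/-- The collective noise: one real number for each training case `i`, epoch `j` and connection,
with the Euclidean norm. -/
abbrev Noise {L : ℕ} (m : Fin (L + 1) → ℕ) (n k : ℕ) : Type :=
  EuclideanSpace ℝ (Fin n × Fin k × Edge m)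

/-- The noise perturbed empirical loss function with `n` training cases and `k` epochs. -/
def pelf {L : ℕ} {m : Fin (L + 1) → ℕ} (act : Activations m) (w : Weights m) (b : Biases m)
    {n : ℕ} (k : ℕ) (x : Fin n → Nodes (m 0)) (y : Fin n → Nodes (m (Fin.last L)))
    (e : Noise m n k) : ℝ :=
  ((k : ℝ) * n)⁻¹ * ∑ j : Fin k, ∑ i : Fin n,
    ‖output act w b (x i) (fun a => e (i, j, a)) - y i‖ ^ 2

/-- The variance `σ² |w|^(-γ) + lam` of the whiteout noise on a connection of weight `w`.
For `w = 0` the power is read as `0`; any other reading gives the same perturbed network,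
as the noise on that connection is multiplied by the weight `0`. -/
def noiseVar (σ γ lam w : ℝ) : ℝ≥0 :=
  Real.toNNReal (σ ^ 2 * |w| ^ (-γ) + lam)

/-- `e` is Gaussian whiteout noise: independent centred Gaussian variables with variances given
by the weights. -/
structure IsWhiteoutNoise {L : ℕ} {m : Fin (L + 1) → ℕ} (σ γ lam : ℝ) (w : Weights m) {n k : ℕ}
    {Ω : Type*} [MeasurableSpace Ω] (μ : Measure Ω) (e : Ω → Noise m n k) : Prop where
  indep : iIndepFun (fun (a : Fin n × Fin k × Edge m) ω => e ω a) μ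
  law : ∀ (i : Fin n) (j : Fin k) (a : Edge m),
    HasLaw (fun ω => e ω (i, j, a)) (gaussianReal 0 (noiseVar σ γ lam (w a.1 a.2.1 a.2.2))) μ

end Whiteout

end

/-!
Over weights bounded by `R`, each layer is Lipschitz in the noise with a uniform constant, by
induction on the layer. Where the squared errors are at most `M`, squaring multiplies the Lipschitz
constant of the output by `2 √M`, and averaging `k n` losses that see disjoint blocks of the noise
gains a factor `1 / √(k n)` by Cauchy-Schwarz. The losses of different blocks are independent random
variables in `[0, M]`, so the tail bound is Hoeffding's inequality for their mean.
-/

namespace Whiteout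

section Probability

variable {ι Ω : Type*} [MeasurableSpace Ω] {μ : Measure Ω}

lemma iIndepFun_curry {κ β : Type*} [Countable ι] [Countable κ] [MeasurableSpace β]
    [IsProbabilityMeasure μ] {X : ι → κ → Ω → β} (hX : ∀ i j, AEMeasurable (X i j) μ)
    (h : iIndepFun (fun (p : ι × κ) ω => X p.1 p.2 ω) μ) :
    iIndepFun (fun i ω j => X i j ω) μ := by
  have hrow : ∀ i, AEMeasurable (fun ω j => X i j ω) μ := fun i => aemeasurable_pi_iff.2 (hX i)
  have hall : AEMeasurable (fun ω (p : ι × κ) => X p.1 p.2 ω) μ :=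
    aemeasurable_pi_iff.2 fun p => hX p.1 p.2
  have : ∀ i j, IsProbabilityMeasure (μ.map (X i j)) :=
    fun i j => Measure.isProbabilityMeasure_map (hX i j)
  have hmap_row : ∀ i,
      μ.map (fun ω j => X i j ω) = Measure.infinitePi (fun j => μ.map (X i j)) := fun i =>
    (h.precomp (g := fun j => (i, j)) (Prod.mk_right_injective i)).map_fun_eq_infinitePi_map₀
      (hrow i)
  rw [iIndepFun_iff_map_fun_eq_infinitePi_map₀' hrow]
  simp_rw [hmap_row]
  calc μ.map (fun ω i j => X i j ω)
      = (μ.map fun ω (p : ι × κ) => X p.1 p.2 ω).map (MeasurableEquiv.curry ι κ β) :=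
        (AEMeasurable.map_map_of_aemeasurable
          (MeasurableEquiv.curry ι κ β).measurable.aemeasurable hall).symm
    _ = (Measure.infinitePi fun p : ι × κ => μ.map (X p.1 p.2)).map
          (MeasurableEquiv.curry ι κ β) := by rw [h.map_fun_eq_infinitePi_map₀ hall]
    _ = Measure.infinitePi fun i => Measure.infinitePi fun j => μ.map (X i j) :=
        Measure.infinitePi_map_curry (fun i j => μ.map (X i j))

lemma measureReal_abs_ge_le_of_hasSubgaussianMGF {X : Ω → ℝ} {c : ℝ≥0}
    (hX : HasSubgaussianMGF X c μ) {ε : ℝ} (hε : 0 ≤ ε) :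
    μ.real {ω | ε ≤ |X ω|} ≤ 2 * Real.exp (-ε ^ 2 / (2 * c)) := by
  have hunion : {ω | ε ≤ |X ω|} = {ω | ε ≤ X ω} ∪ {ω | ε ≤ (-X) ω} :=
    Set.ext fun ω => le_abs (a := ε) (b := X ω)
  calc μ.real {ω | ε ≤ |X ω|}
      ≤ μ.real {ω | ε ≤ X ω} + μ.real {ω | ε ≤ (-X) ω} := hunion ▸ measureReal_union_le _ _
    _ ≤ Real.exp (-ε ^ 2 / (2 * c)) + Real.exp (-ε ^ 2 / (2 * c)) :=
        add_le_add (hX.measure_ge_le hε) (hX.neg.measure_ge_le hε)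
    _ = 2 * Real.exp (-ε ^ 2 / (2 * c)) := (two_mul _).symm

variable [Fintype ι] [IsProbabilityMeasure μ] {Z : ι → Ω → ℝ} {a b : ℝ}

/-- **Hoeffding's inequality**, two-sided. -/
lemma measureReal_abs_sum_sub_integral_ge_le (hZ : ∀ i, AEMeasurable (Z i) μ)
    (hZab : ∀ i, ∀ᵐ ω ∂μ, Z i ω ∈ Set.Icc a b) (hind : iIndepFun Z μ) {ε : ℝ} (hε : 0 ≤ ε) :
    μ.real {ω | ε ≤ |∑ i, (Z i ω - μ[Z i])|}
      ≤ 2 * Real.exp (-(2 * ε ^ 2 / (Fintype.card ι * (b - a) ^ 2))) := by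
  have hsub : HasSubgaussianMGF (fun ω => ∑ i, (Z i ω - μ[Z i]))
      (∑ _i : ι, (‖b - a‖₊ / 2) ^ 2) μ :=
    HasSubgaussianMGF.sum_of_iIndepFun
      (hind.comp (fun i z => z - μ[Z i]) fun i => measurable_id.sub_const _)
      (c := fun _ => (‖b - a‖₊ / 2) ^ 2) fun i _ => hasSubgaussianMGF_of_mem_Icc (hZ i) (hZab i)
  have hparam : ((∑ _i : ι, (‖b - a‖₊ / 2) ^ 2 : ℝ≥0) : ℝ)
      = Fintype.card ι * (b - a) ^ 2 / 4 := by
    simp only [Finset.sum_const, Finset.card_univ, nsmul_eq_mul, NNReal.coe_mul,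
      NNReal.coe_natCast, NNReal.coe_pow, NNReal.coe_div, coe_nnnorm, NNReal.coe_ofNat, div_pow,
      Real.norm_eq_abs, sq_abs]
    ring
  convert measureReal_abs_ge_le_of_hasSubgaussianMGF hsub hε using 3
  rw [hparam]
  generalize Fintype.card ι * (b - a) ^ 2 = q
  ring

lemma measureReal_abs_mean_sub_integral_gt_le (hZ : ∀ i, AEMeasurable (Z i) μ)
    (hZab : ∀ i, ∀ᵐ ω ∂μ, Z i ω ∈ Set.Icc a b) (hind : iIndepFun Z μ) {δ : ℝ} (hδ : 0 ≤ δ) :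
    μ.real {ω | δ < |(Fintype.card ι : ℝ)⁻¹ * ∑ i, Z i ω
        - ∫ ω', (Fintype.card ι : ℝ)⁻¹ * ∑ i, Z i ω' ∂μ|}
      ≤ 2 * Real.exp (-(2 * Fintype.card ι * δ ^ 2 / (b - a) ^ 2)) := by
  set N : ℝ := (Fintype.card ι : ℝ)
  have hdev : ∀ ω, N⁻¹ * ∑ i, Z i ω - ∫ ω', N⁻¹ * ∑ i, Z i ω' ∂μ
      = (∑ i, (Z i ω - μ[Z i])) / N := fun ω => by
    rw [integral_const_mul, integral_finsetSum _ fun i _ =>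
      Integrable.of_mem_Icc a b (hZ i) (hZab i), Finset.sum_sub_distrib]
    ring
  have hscale : 2 * (δ * N) ^ 2 / (N * (b - a) ^ 2) = 2 * N * δ ^ 2 / (b - a) ^ 2 := by
    rcases eq_or_ne N 0 with h0 | h0
    · simp [h0]
    · field_simp
  calc _ ≤ μ.real {ω | δ * N ≤ |∑ i, (Z i ω - μ[Z i])|} := by
        refine measureReal_mono fun ω (hω : δ < _) => ?_
        rw [hdev, abs_div, Nat.abs_cast] at hω
        exact mul_le_of_le_div₀ (abs_nonneg _) (Nat.cast_nonneg _) hω.le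
    _ ≤ _ := hscale ▸ measureReal_abs_sum_sub_integral_ge_le hZ hZab hind (by positivity)

end Probability

section Lipschitz

lemma lipschitzWith_norm_sq_of_norm_le {α E : Type*} [PseudoMetricSpace α]
    [SeminormedAddCommGroup E] {F : α → E} {K r : ℝ≥0} (hF : LipschitzWith K F)
    (hr : ∀ a, ‖F a‖ ≤ r) :
    LipschitzWith (2 * r * K) fun a => ‖F a‖ ^ 2 := by
  refine LipschitzWith.of_dist_le_mul fun a a' => ?_
  have hnorm : |‖F a‖ - ‖F a'‖| ≤ K * dist a a' :=
    (abs_norm_sub_norm_le _ _).trans (dist_eq_norm (F a) (F a') ▸ hF.dist_le_mul a a')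
  calc dist (‖F a‖ ^ 2) (‖F a'‖ ^ 2)
      = (‖F a‖ + ‖F a'‖) * |‖F a‖ - ‖F a'‖| := by
        rw [Real.dist_eq, sq_sub_sq, abs_mul, abs_of_nonneg (by positivity)]
    _ ≤ (2 * r) * (K * dist a a') := by
        gcongr
        linarith [hr a, hr a']
    _ = ↑(2 * r * K) * dist a a' := by push_cast; ring

lemma pi_norm_sq_le_sum_norm_sq {κ E : Type*} [Fintype κ] [SeminormedAddGroup E] (u : κ → E) :
    ‖u‖ ^ 2 ≤ ∑ j, ‖u j‖ ^ 2 := by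
  refine (Real.le_sqrt (norm_nonneg _) (by positivity)).1 ?_
  refine (pi_norm_le_iff_of_nonneg (Real.sqrt_nonneg _)).2 fun j => Real.le_sqrt_of_sq_le ?_
  exact Finset.single_le_sum (f := fun j => ‖u j‖ ^ 2) (fun _ _ => sq_nonneg _)
    (Finset.mem_univ j)

lemma sum_pi_norm_le_sqrt_card_mul_sqrt {ι κ E : Type*} [Fintype ι] [Fintype κ]
    [SeminormedAddGroup E] (v : ι → κ → E) :
    ∑ i, ‖v i‖ ≤ √(Fintype.card ι) * √(∑ i, ∑ j, ‖v i j‖ ^ 2) := by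
  rw [← Real.sqrt_mul (Nat.cast_nonneg _)]
  refine Real.le_sqrt_of_sq_le ?_
  calc (∑ i, ‖v i‖) ^ 2 ≤ Fintype.card ι * ∑ i, ‖v i‖ ^ 2 := sq_sum_le_card_mul_sum_sq
    _ ≤ Fintype.card ι * ∑ i, ∑ j, ‖v i j‖ ^ 2 := by
        gcongr with i
        exact pi_norm_sq_le_sum_norm_sq (v i)

end Lipschitz

variable {L : ℕ} {m : Fin (L + 1) → ℕ} {act : Activations m} {w : Weights m} {b : Biases m}

section Network

/-- The vector `u^(l+1)` of inputs to the activation `act l`, when layer `l` has the values `X`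
and the noise is `e`. -/
noncomputable def preactivation (w : Weights m) (b : Biases m) (l : Fin L)
    (X : Nodes (m l.castSucc)) (e : Edge m → ℝ) : Fin (m l.succ) → ℝ :=
  fun k => b l k + ∑ j, w l j k * (X j + e ⟨l, j, k⟩)

lemma layer_succ (x : Nodes (m 0)) (e : Edge m → ℝ) (l : Fin L) :
    layer act w b x e l.succ
      = act l (WithLp.toLp 2 (preactivation w b l (layer act w b x e l.castSucc) e)) :=
  Fin.induction_succ ..

lemma lipschitzWith_preactivation {l : Fin L} {R K : ℝ≥0} (hw : ∀ j k, |w l j k| ≤ R)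
    {X : (Edge m → ℝ) → Nodes (m l.castSucc)} (hX : LipschitzWith K X) :
    LipschitzWith (m l.castSucc * (R * (K + 1))) fun e => preactivation w b l (X e) e := by
  refine LipschitzWith.of_dist_le_mul fun e e' => (dist_pi_le_iff (by positivity)).2 fun k => ?_
  have hsignal : ∀ j, dist (w l j k * (X e j + e ⟨l, j, k⟩)) (w l j k * (X e' j + e' ⟨l, j, k⟩))
      ≤ R * (K + 1) * dist e e' := fun j =>
    calc dist (w l j k * (X e j + e ⟨l, j, k⟩)) (w l j k * (X e' j + e' ⟨l, j, k⟩))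
        = |w l j k| * dist (X e j + e ⟨l, j, k⟩) (X e' j + e' ⟨l, j, k⟩) := by
          rw [Real.dist_eq, Real.dist_eq, ← mul_sub, abs_mul]
      _ ≤ R * (dist (X e j) (X e' j) + dist (e ⟨l, j, k⟩) (e' ⟨l, j, k⟩)) := by
          gcongr
          exacts [hw j k, dist_add_add_le _ _ _ _]
      _ ≤ R * (K * dist e e' + dist e e') := by
          gcongr
          exacts [(PiLp.dist_apply_le _ _ j).trans (hX.dist_le_mul e e'), dist_le_pi_dist e e' _]
      _ = R * (K + 1) * dist e e' := by ring
  calc dist (preactivation w b l (X e) e k) (preactivation w b l (X e') e' k)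
      ≤ ∑ j, dist (w l j k * (X e j + e ⟨l, j, k⟩)) (w l j k * (X e' j + e' ⟨l, j, k⟩)) := by
        rw [preactivation, preactivation, dist_add_left]
        exact dist_sum_sum_le _ _ _
    _ ≤ ∑ _j : Fin (m l.castSucc), R * (K + 1) * dist e e' := by
        gcongr with j
        exact hsignal j
    _ = ↑(m l.castSucc * (R * (K + 1))) * dist e e' := by
        simp only [Finset.sum_const, Finset.card_univ, Fintype.card_fin, nsmul_eq_mul]
        push_cast
        ring

lemma exists_lipschitzWith_layer (hact : ∀ l, ∃ K : ℝ≥0, LipschitzWith K (act l)) (R : ℝ≥0)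
    (l : Fin (L + 1)) :
    ∃ K : ℝ≥0, ∀ (w : Weights m) (b : Biases m) (x : Nodes (m 0)),
      (∀ l j k, |w l j k| ≤ R) → LipschitzWith K fun e => layer act w b x e l := by
  induction l using Fin.induction with
  | zero => exact ⟨0, fun _ _ x _ => LipschitzWith.const x⟩
  | succ l ih =>
    obtain ⟨K, hK⟩ := ih
    obtain ⟨A, hA⟩ := hact l
    refine ⟨A * (Fintype.card (Fin (m l.succ)) ^ (1 / 2 : ENNReal).toReal
      * (m l.castSucc * (R * (K + 1)))), fun w b x hw => ?_⟩
    simp only [layer_succ]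
    exact hA.comp ((PiLp.lipschitzWith_toLp 2 _).comp
      (lipschitzWith_preactivation (hw l) (hK w b x hw)))

end Network

section Loss

/-- The squared error `‖f(x, e ∣ w, b) - y‖²` of one training case under the noise `e` of one
epoch. -/
noncomputable def sqLoss (act : Activations m) (w : Weights m) (b : Biases m) (x : Nodes (m 0))
    (y : Nodes (m (Fin.last L))) (e : Edge m → ℝ) : ℝ :=
  ‖output act w b x e - y‖ ^ 2

lemma lipschitzWith_sqLoss {x : Nodes (m 0)} {y : Nodes (m (Fin.last L))} {K : ℝ≥0} {M : ℝ}
    (houtput : LipschitzWith K (output act w b x)) (hM : ∀ e, sqLoss act w b x y e ≤ M) :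
    LipschitzWith (2 * (√M).toNNReal * K) (sqLoss act w b x y) :=
  lipschitzWith_norm_sq_of_norm_le (add_zero K ▸ houtput.sub (.const y)) fun e =>
    (Real.le_sqrt_of_sq_le (hM e)).trans (Real.le_coe_toNNReal _)

variable {n k : ℕ}

/-- The noise `e_ij` that training case `i` meets in epoch `j`, where `p = (i, j)`. As a function
on the connections it carries the sup norm, unlike the collective noise. -/
def noiseBlock (e : Noise m n k) (p : Fin n × Fin k) : Edge m → ℝ :=
  fun a => e (p.1, p.2, a)

lemma measurable_noiseBlock (p : Fin n × Fin k) :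
    Measurable fun e : Noise m n k => noiseBlock e p :=
  measurable_pi_iff.2 fun a => (measurable_pi_apply (p.1, p.2, a)).comp (WithLp.measurable_ofLp 2 _)

lemma cast_card_fin_prod_fin : (Fintype.card (Fin n × Fin k) : ℝ) = k * n := by
  simp [mul_comm]

lemma sum_dist_noiseBlock_le (e e' : Noise m n k) :
    ∑ p, dist (noiseBlock e p) (noiseBlock e' p) ≤ √((k : ℝ) * n) * dist e e' := by
  have hblocks := sum_pi_norm_le_sqrt_card_mul_sqrt fun p => noiseBlock (e - e') p
  have hnorm : ‖e - e'‖ = √(∑ p, ∑ a, ‖noiseBlock (e - e') p a‖ ^ 2) := by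
    simp_rw [EuclideanSpace.norm_eq, Fintype.sum_prod_type, noiseBlock]
  rw [← hnorm, cast_card_fin_prod_fin] at hblocks
  simp_rw [dist_eq_norm]
  exact hblocks

variable {x : Fin n → Nodes (m 0)} {y : Fin n → Nodes (m (Fin.last L))}

lemma pelf_eq_mean (e : Noise m n k) :
    pelf act w b k x y e
      = ((k : ℝ) * n)⁻¹ * ∑ p, sqLoss act w b (x p.1) (y p.1) (noiseBlock e p) := by
  rw [pelf, Finset.sum_comm, Fintype.sum_prod_type]
  rfl

lemma lipschitzWith_pelf {C : ℝ≥0} (hloss : ∀ i, LipschitzWith C (sqLoss act w b (x i) (y i))) :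
    LipschitzWith (Real.toNNReal (C / √((k : ℝ) * n))) (pelf act w b k x y) := by
  refine LipschitzWith.of_dist_le' fun e e' => ?_
  calc dist (pelf act w b k x y e) (pelf act w b k x y e')
      = ((k : ℝ) * n)⁻¹ * dist (∑ p, sqLoss act w b (x p.1) (y p.1) (noiseBlock e p))
          (∑ p, sqLoss act w b (x p.1) (y p.1) (noiseBlock e' p)) := by
        rw [pelf_eq_mean, pelf_eq_mean, Real.dist_eq, ← mul_sub, abs_mul, Real.dist_eq,
          abs_of_nonneg (by positivity)]
    _ ≤ ((k : ℝ) * n)⁻¹ * ∑ p, C * dist (noiseBlock e p) (noiseBlock e' p) := by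
        gcongr
        exact (dist_sum_sum_le _ _ _).trans
          (Finset.sum_le_sum fun p _ => (hloss p.1).dist_le_mul _ _)
    _ ≤ ((k : ℝ) * n)⁻¹ * (C * (√((k : ℝ) * n) * dist e e')) := by
        rw [← Finset.mul_sum]
        gcongr
        exact sum_dist_noiseBlock_le e e'
    _ = C / √((k : ℝ) * n) * dist e e' := by
        rw [div_eq_mul_inv, ← Real.sqrt_div_self]
        ring

variable {Ω : Type*} [MeasurableSpace Ω] {μ : Measure Ω} {e : Ω → Noise m n k} {M : ℝ}

lemma integrable_pelf [IsFiniteMeasure μ] (hloss : ∀ i, Measurable (sqLoss act w b (x i) (y i)))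
    (hM : ∀ i v, sqLoss act w b (x i) (y i) v ≤ M) (he : AEMeasurable e μ) :
    Integrable (fun ω => pelf act w b k x y (e ω)) μ := by
  simp_rw [pelf_eq_mean]
  exact (integrable_finsetSum _ fun p _ => Integrable.of_mem_Icc 0 M
    (((hloss p.1).comp (measurable_noiseBlock p)).comp_aemeasurable he)
    (.of_forall fun _ => ⟨sq_nonneg _, hM _ _⟩)).const_mul _

lemma measureReal_abs_pelf_sub_integral_gt_le [IsProbabilityMeasure μ]
    (hloss : ∀ i, Measurable (sqLoss act w b (x i) (y i)))
    (hM : ∀ i v, sqLoss act w b (x i) (y i) v ≤ M) (he : AEMeasurable e μ)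
    (hind : iIndepFun (fun p ω => noiseBlock (e ω) p) μ) {δ : ℝ} (hδ : 0 ≤ δ) :
    μ.real {ω | δ < |pelf act w b k x y (e ω) - ∫ ω', pelf act w b k x y (e ω') ∂μ|}
      ≤ 2 * Real.exp (-(2 * (k * n) * δ ^ 2 / M ^ 2)) := by
  let Z : Fin n × Fin k → Ω → ℝ := fun p ω => sqLoss act w b (x p.1) (y p.1) (noiseBlock (e ω) p)
  have hZ : ∀ p, AEMeasurable (Z p) μ := fun p =>
    ((hloss p.1).comp (measurable_noiseBlock p)).comp_aemeasurable he
  have hZM : ∀ p, ∀ᵐ ω ∂μ, Z p ω ∈ Set.Icc 0 M := fun p =>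
    .of_forall fun _ => ⟨sq_nonneg _, hM p.1 _⟩
  have hZind : iIndepFun Z μ :=
    hind.comp (fun p => sqLoss act w b (x p.1) (y p.1)) fun p => hloss p.1
  have hhoeffding := measureReal_abs_mean_sub_integral_gt_le hZ hZM hZind hδ
  rw [sub_zero, cast_card_fin_prod_fin] at hhoeffding
  simp_rw [pelf_eq_mean]
  exact hhoeffding

end Loss

namespace IsWhiteoutNoise

variable {n k : ℕ} {σ γ lam : ℝ} {Ω : Type*} [MeasurableSpace Ω] {μ : Measure Ω}
  {e : Ω → Noise m n k}

protected lemma aemeasurable (he : IsWhiteoutNoise σ γ lam w μ e) : AEMeasurable e μ :=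
  (WithLp.measurable_toLp 2 _).comp_aemeasurable
    (aemeasurable_pi_iff.2 fun p => (he.law p.1 p.2.1 p.2.2).aemeasurable)

lemma iIndepFun_noiseBlock [IsProbabilityMeasure μ] (he : IsWhiteoutNoise σ γ lam w μ e) :
    iIndepFun (fun p ω => noiseBlock (e ω) p) μ :=
  iIndepFun_curry (fun p a => (he.law p.1 p.2 a).aemeasurable)
    (he.indep.precomp (Equiv.prodAssoc _ _ _).injective)

end IsWhiteoutNoise

end Whiteout

open Whiteout in
theorem corollary3_general {L : ℕ} (m : Fin (L + 1) → ℕ) (act : Activations m)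
    (hact : ∀ l, ∃ K : ℝ≥0, LipschitzWith K (act l)) (R M : ℝ) :
    ∃ B : ℝ, 0 < B ∧
      ∀ (n k : ℕ), 0 < n → 0 < k →
      ∀ (x : Fin n → Nodes (m 0)) (y : Fin n → Nodes (m (Fin.last L)))
        (w : Weights m) (b : Biases m),
      (∀ l j k', |w l j k'| ≤ R) →
      (∀ i (e : Edge m → ℝ), ‖output act w b (x i) e - y i‖ ^ 2 ≤ M) →
      LipschitzWith (Real.toNNReal (B / √((k : ℝ) * n))) (pelf act w b k x y) ∧
      ∀ {Ω : Type*} [MeasurableSpace Ω] (μ : Measure Ω) [IsProbabilityMeasure μ]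
        (e : Ω → Noise m n k), AEMeasurable e μ →
        iIndepFun (fun p ω => noiseBlock (e ω) p) μ →
        Integrable (fun ω => pelf act w b k x y (e ω)) μ ∧
        ∀ δ : ℝ, 0 < δ →
          μ.real {ω | δ < |pelf act w b k x y (e ω) - ∫ ω', pelf act w b k x y (e ω') ∂μ|}
            ≤ 2 * Real.exp (-((k : ℝ) * n * δ ^ 2 / (2 * B ^ 2))) := by
  obtain ⟨K, hK⟩ := exists_lipschitzWith_layer hact R.toNNReal (Fin.last L)
  -- `2 √M K` bounds the Lipschitz constant of a loss; Hoeffding on `[0, 2 B]` requires `M ≤ 2 B`.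
  set B : ℝ≥0 := max (2 * (√M).toNNReal * K) (max M.toNNReal 1) with hB
  have hB0 : 0 < (B : ℝ) := by simp [hB]
  refine ⟨B, hB0, fun n k _ _ x y w b hw hM => ?_⟩
  have hloss : ∀ i, LipschitzWith B (sqLoss act w b (x i) (y i)) := fun i =>
    (lipschitzWith_sqLoss (hK w b (x i) fun l j k' => (hw l j k').trans (Real.le_coe_toNNReal R))
      (hM i)).weaken (le_max_left _ _)
  have hmeas : ∀ i, Measurable (sqLoss act w b (x i) (y i)) := fun i =>
    (hloss i).continuous.measurable
  have hMB : M ≤ 2 * B := by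
    have : M ≤ B := (Real.le_coe_toNNReal M).trans (by simp [hB])
    linarith
  refine ⟨lipschitzWith_pelf hloss, fun μ _ e he hind =>
    ⟨integrable_pelf hmeas hM he, fun δ hδ => ?_⟩⟩
  convert measureReal_abs_pelf_sub_integral_gt_le hmeas (fun i v => (hM i v).trans hMB) he hind
    hδ.le using 4
  field_simp

theorem corollary3 {L : ℕ} (m : Fin (L + 1) → ℕ) (act : Whiteout.Activations m)
    (hact : ∀ l, ∃ K : ℝ≥0, LipschitzWith K (act l))
    (σ γ lam : ℝ) (hγ : γ ∈ Set.Ioo (0 : ℝ) 2) (hlam : 0 ≤ lam)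
    (R Cy M : ℝ) :
    ∃ B : ℝ, 0 < B ∧
      ∀ (n k : ℕ), 0 < n → 0 < k →
      ∀ (x : Fin n → Whiteout.Nodes (m 0)) (y : Fin n → Whiteout.Nodes (m (Fin.last L)))
        (w : Whiteout.Weights m) (b : Whiteout.Biases m),
      (∀ l j k', |w l j k'| ≤ R) →
      (∀ i, ‖y i‖ ≤ Cy) →
      (∀ i (e : Whiteout.Edge m → ℝ), ‖Whiteout.output act w b (x i) e - y i‖ ^ 2 ≤ M) →
      LipschitzWith (Real.toNNReal (B / √((k : ℝ) * n))) (Whiteout.pelf act w b k x y) ∧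
      ∀ {Ω : Type*} [MeasurableSpace Ω] (μ : Measure Ω) [IsProbabilityMeasure μ]
        (e : Ω → Whiteout.Noise m n k), Whiteout.IsWhiteoutNoise σ γ lam w μ e →
        Integrable (fun ω => Whiteout.pelf act w b k x y (e ω)) μ ∧
        ∀ δ : ℝ, 0 < δ →
          μ.real {ω | δ < |Whiteout.pelf act w b k x y (e ω)
              - ∫ ω', Whiteout.pelf act w b k x y (e ω') ∂μ|}
            ≤ 2 * Real.exp (-((k : ℝ) * n * δ ^ 2 / (2 * B ^ 2))) := by
  obtain ⟨B, hB, h⟩ := corollary3_general m act hact R M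
  exact ⟨B, hB, fun n k hn hk x y w b hw _ hM => (h n k hn hk x y w b hw hM).imp_right
    fun h {_} _ μ _ e he => h μ e he.aemeasurable he.iIndepFun_noiseBlock⟩
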